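/- **Setting.** Let $\mathfrak g=\mathfrak k\oplus\mathfrak p$ be a fixed decomposition of a finite-dimensional real vector space, let $r\neq s$, $\alpha<1$, and let $\gamma$ be a tensor of type $(r,s)$ on $\mathfrak p$ (i.e. a multilinear map $\mathfrak p^r\to\mathfrak p^{\otimes s}$) or a tuple of such tensors. $\mathrm{GL}(\mathfrak p)$ acts on tensors by $h\cdot\gamma=h^{\otimes s}\gamma(h^{-1}\cdot,\dots,h^{-1}\cdot)$, and $\theta$ denotes the corresponding representation of $\mathfrak{gl}(\mathfrak p)$, and likewise of $\mathfrak{gl}(\mathfrak g)$ on brackets: $\theta(A)\mu=A\mu(\cdot,\cdot)-\mu(A\cdot,\cdot)-\mu(\cdot,A\cdot)$. Assume that $\mathrm{GL}(\mathfrak p)\cdot\gamma$ is open in a linear subspace $T$ of the space of (tuples of) tensors of type $(r,s)$. Let $\mathfrak{gl}(\mathfrak p)_\gamma=\{A:\theta(A)\gamma=0\}$ and fix a decomposition $\mathfrak{gl}(\mathfrak p)=\mathfrak{gl}(\mathfrak p)_\gamma\oplus\mathfrak q_\gamma$ invariant under conjugation by the stabilizer $\mathrm{GL}(\mathfrak p)_\gamma$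 and such that $I\in\mathfrak q_\gamma$; let $\mathrm{proj}_\gamma:\mathfrak{gl}(\mathfrak p)\to\mathfrak q_\gamma$ be the corresponding projection. Let $q$ be a preferred direction for geometric structures of the type of $\gamma$: on each smooth manifold $M$ with $\dim M=\dim\mathfrak p$ there is a set $\Gamma(M)$ of (tuples of) tensor fields which at every point correspond to $\gamma$ under some isomorphism $\mathfrak p\cong T_xM$, and to each $\tau\in\Gamma(M)$ is assigned a (tuple of) tensor field(s) $q(\tau)$ of type $(r,s)$ on $M$ whose value at $x$ corresponds to an element of $T$ under any such isomorphism; $\Gamma$ is preserved by pull-back by diffeomorphisms and by positive scalings, $q(f^*\tau)=f^*q(\tau)$ for every diffeomorphism $f$, and $q(c\tau)=c^\alpha q(\tau)$ for all $c>0$. Let $\mathcal H^\gamma$ be the set of Lie brackets $\mu$ on $\mathfrak g$ such that (i) $\mu(\mathfrak k,\mathfrak k)\subset\mathfrak k$ and $\mu(\mathfrak k,\mathfrak p)\subset\mathfrak p$; (ii) $K_\mu$ is closed in $G_\mu$, where $G_\mu$ is the simply connected Lie group with Lie algebra $(\mathfrak g,\mu)$ and $K_\mu$ its connected Lie subgroup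 with Lie algebra $\mathfrak k$; (iii) $\{Z\in\mathfrak k:\mu(Z,\mathfrak p)=0\}=0$; (iv) $\theta(\mathrm{ad}_\mu Z|_{\mathfrak p})\gamma=0$ for all $Z\in\mathfrak k$. For $\mu\in\mathcal H^\gamma$, $\gamma$ defines a $G_\mu$-invariant structure on $G_\mu/K_\mu$ (with $T_o(G_\mu/K_\mu)\equiv\mathfrak p$); when it belongs to $\Gamma(G_\mu/K_\mu)$, let $q(G_\mu/K_\mu,\gamma)$ be the value at the origin of its preferred direction and let $Q_\mu\in\mathfrak q_\gamma$ be the operator with $\theta(Q_\mu)\gamma=q(G_\mu/K_\mu,\gamma)$. $(G_\mu/K_\mu,\gamma)$ is an *algebraic soliton* with constant $c\in\mathbb R$ and derivation $D$ if $D$ is a derivation of $(\mathfrak g,\mu)$ with $D(\mathfrak k)\subset\mathfrak k$ whose $\mathfrak p$-block $D_{\mathfrak p}$ satisfies $$Q_\mu=\tfrac{c}{s-r}I+\mathrm{proj}_\gamma(D_{\mathfrak p}),\qquad \mathrm{proj}_\gamma(D_{\mathfrak p})=D_{\mathfrak p}$$ (in particular, $Q_\mu$ is defined). For $c\in\mathbb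 R^*$ let $c\cdot\mu$ be the bracket equal to $\mu$ on $\mathfrak k\times\mathfrak k$ and $\mathfrak k\times\mathfrak p$, and to $c^2\mu_{\mathfrak k}+c\,\mu_{\mathfrak p}$ on $\mathfrak p\times\mathfrak p$. The *bracket flow* is the equation $$\tfrac{d}{dt}\mu(t)=\sigma\,\theta\!\left(\begin{bmatrix}0&0\\0&Q_{\mu(t)}\end{bmatrix}\right)\mu(t),\qquad \mu(0)=\mu,$$ for curves in $\mathcal H^\gamma$ along which $Q_{\mu(t)}$ is defined, where $\sigma\in\{1,-1\}$ is a sign convention ($\sigma=-1$ is the sign for which this flow is equivalent to the flow $\frac{d}{dt}\gamma(t)=q(\gamma(t))$ on $G_\mu/K_\mu$; the other choice reverses time). $\mu$ is a *fixed point up to scaling* of the bracket flow if on some open interval around $0$ it has a solution starting at $\mu$ of the form $\mu(t)=c(t)\cdot\mu$ with $c(t)\in\mathbb R^*$. **Statement.** Let $\mu\in\mathcal H^\gamma$ and let $\sigma\in\{1,-1\}$ be either sign. Then $(G_\mu/K_\mu,\gamma)$ is an algebraic soliton, for some constant $c$ and some derivation of the form $D=\begin{bmatrix}0&0\\0&D_{\mathfrak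 p}\end{bmatrix}$, if and only if $\mu$ is a fixed point, up to scaling, of the bracket flow. -/

import Mathlib

open scoped Manifold ContDiff Topology

noncomputable section

namespace HomSoliton

/-! ### Tensors on a vector space -/

/-- Tensors of type `(r, s)` on a real vector space `V`: multilinear maps from `r` copies of `V` to
the `s`-fold tensor power of `V`. -/
abbrev Tensor (r s : ℕ) (V : Type*) [AddCommGroup V] [Module ℝ V] : Type _ :=
  MultilinearMap ℝ (fun _ : Fin r => V) (PiTensorProduct ℝ (fun _ : Fin s => V))

/-- `m`-tuples of tensors of type `(r, s)`; `m = 1` is the case of one tensor. -/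
abbrev Tensors (m r s : ℕ) (V : Type*) [AddCommGroup V] [Module ℝ V] : Type _ :=
  Fin m → Tensor r s V

section LinearAlgebra

variable {m r s : ℕ} {V W : Type*} [AddCommGroup V] [Module ℝ V] [AddCommGroup W] [Module ℝ W]

/-- The left action `h · γ = h^{⊗ s} γ(h⁻¹ ·, …, h⁻¹ ·)`, for an isomorphism `h : V → W`. -/
def act (h : V ≃ₗ[ℝ] W) (γ : Tensors m r s V) : Tensors m r s W := fun i =>
  (PiTensorProduct.map (fun _ => h.toLinearMap)).compMultilinearMap
    ((γ i).compLinearMap (fun _ => h.symm.toLinearMap))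

/-- `γ` on `V` and `γ'` on `W` are related by `A : V → W`: `A^{⊗ s} γ(v₁, …) = γ'(A v₁, …)`.  If `A`
is invertible, this says `γ' = A · γ`, that is, `γ = A^* γ'`. -/
def Related (A : V →ₗ[ℝ] W) (γ : Tensors m r s V) (γ' : Tensors m r s W) : Prop :=
  ∀ (i : Fin m) (v : Fin r → V),
    PiTensorProduct.map (fun _ => A) (γ i v) = γ' i (fun j => A (v j))

theorem related_iff_act_eq (h : V ≃ₗ[ℝ] W) (γ : Tensors m r s V) (γ' : Tensors m r s W) :
    Related h.toLinearMap γ γ' ↔ act h γ = γ' := by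
  constructor
  · intro H
    funext i
    ext v
    have := H i (fun j => h.symm (v j))
    simpa [act] using this
  · rintro rfl i v
    simp [act]

/-- The representation `θ` of `gl(V)` on tensors:
`θ(A)γ = θ_s(A) γ - γ(A ·, …, ·) - … - γ(·, …, A ·)`, where `θ_s(A)` acts on the `s`-fold tensor
power of `V` as a derivation. -/
def θ (A : Module.End ℝ V) (γ : Tensors m r s V) : Tensors m r s V := fun i =>
  (∑ l : Fin s, PiTensorProduct.map
      (Function.update (fun _ : Fin s => (LinearMap.id : V →ₗ[ℝ] V)) l A)).compMultilinearMap (γ i)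
    - ∑ j : Fin r,
        (γ i).compLinearMap (Function.update (fun _ : Fin r => (LinearMap.id : V →ₗ[ℝ] V)) j A)

theorem θ_add (A B : Module.End ℝ V) (γ : Tensors m r s V) : θ (A + B) γ = θ A γ + θ B γ := by
  funext i
  ext v
  have e1 : ∀ l : Fin s, PiTensorProduct.map (R := ℝ)
        (Function.update (fun _ : Fin s => (LinearMap.id : V →ₗ[ℝ] V)) l (A + B)) =
      PiTensorProduct.map (Function.update (fun _ : Fin s => (LinearMap.id : V →ₗ[ℝ] V)) l A) +
      PiTensorProduct.map (Function.update (fun _ : Fin s => (LinearMap.id : V →ₗ[ℝ] V)) l B) :=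
    fun l => (PiTensorProduct.mapMultilinear ℝ (fun _ : Fin s => V) (fun _ => V)).map_update_add
      _ l A B
  have e2 : ∀ j : Fin r, (γ i).compLinearMap
        (Function.update (fun _ : Fin r => (LinearMap.id : V →ₗ[ℝ] V)) j (A + B)) =
      (γ i).compLinearMap (Function.update (fun _ : Fin r => (LinearMap.id : V →ₗ[ℝ] V)) j A) +
      (γ i).compLinearMap (Function.update (fun _ : Fin r => (LinearMap.id : V →ₗ[ℝ] V)) j B) := by
    intro j
    exact congrArg (fun f => f (γ i)) ((MultilinearMap.compLinearMapMultilinear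
      (R := ℝ) (M₁ := fun _ : Fin r => V) (M₁' := fun _ : Fin r => V)
      (M₂ := PiTensorProduct ℝ (fun _ : Fin s => V))).map_update_add _ j A B)
  simp only [θ, e1, e2, Finset.sum_add_distrib, Pi.add_apply, add_apply,
    sub_apply, LinearMap.compMultilinearMap_apply, LinearMap.add_apply]
  abel

theorem θ_smul (c : ℝ) (A : Module.End ℝ V) (γ : Tensors m r s V) :
    θ (c • A) γ = c • θ A γ := by
  funext i
  ext v
  have e1 : ∀ l : Fin s, PiTensorProduct.map (R := ℝ)
        (Function.update (fun _ : Fin s => (LinearMap.id : V →ₗ[ℝ] V)) l (c • A)) =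
      c • PiTensorProduct.map (Function.update (fun _ : Fin s => (LinearMap.id : V →ₗ[ℝ] V)) l A) :=
    fun l => (PiTensorProduct.mapMultilinear ℝ (fun _ : Fin s => V) (fun _ => V)).map_update_smul
      _ l c A
  have e2 : ∀ j : Fin r, (γ i).compLinearMap
        (Function.update (fun _ : Fin r => (LinearMap.id : V →ₗ[ℝ] V)) j (c • A)) =
      c • (γ i).compLinearMap
        (Function.update (fun _ : Fin r => (LinearMap.id : V →ₗ[ℝ] V)) j A) := by
    intro j
    exact congrArg (fun f => f (γ i)) ((MultilinearMap.compLinearMapMultilinear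
      (R := ℝ) (M₁ := fun _ : Fin r => V) (M₁' := fun _ : Fin r => V)
      (M₂ := PiTensorProduct ℝ (fun _ : Fin s => V))).map_update_smul _ j c A)
  simp only [θ, e1, e2, ← Finset.smul_sum, Pi.smul_apply, smul_apply,
    sub_apply, LinearMap.compMultilinearMap_apply, LinearMap.smul_apply, smul_sub]

/-- The Lie algebra `gl(V)_γ = {A : θ(A)γ = 0}` of the stabilizer of `γ`. -/
def stab (γ : Tensors m r s V) : Submodule ℝ (Module.End ℝ V) where
  carrier := {A | θ A γ = 0}
  add_mem' {A B} hA hB := by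
    simp only [Set.mem_ofPred_eq] at *
    rw [θ_add, hA, hB, add_zero]
  zero_mem' := by
    have := θ_smul (0 : ℝ) (0 : Module.End ℝ V) γ
    simpa using this
  smul_mem' c A hA := by
    simp only [Set.mem_ofPred_eq] at *
    rw [θ_smul, hA, smul_zero]

/-- `GL(V) · γ` is contained in the subspace `T` and is open in `T`, for the canonical topology of
the finite-dimensional real vector space `T`. -/
def OrbitIsOpenIn (γ : Tensors m r s V) (T : Submodule ℝ (Tensors m r s V)) : Prop :=
  (∀ h : V ≃ₗ[ℝ] V, act h γ ∈ T) ∧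
    IsOpen[moduleTopology ℝ T] {x : T | ∃ h : V ≃ₗ[ℝ] V, act h γ = x}

/-- `𝔮` is a complement `𝔮_γ` of the stabilizer algebra `gl(V)_γ` in `gl(V)`, invariant under
conjugation by the stabilizer group `GL(V)_γ`, and it contains the identity. -/
structure IsComplement (γ : Tensors m r s V) (𝔮 : Submodule ℝ (Module.End ℝ V)) : Prop where
  isCompl : IsCompl 𝔮 (stab γ)
  conj_mem : ∀ h : V ≃ₗ[ℝ] V, act h γ = γ → ∀ A ∈ 𝔮, h.conj A ∈ 𝔮
  one_mem : (1 : Module.End ℝ V) ∈ 𝔮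

end LinearAlgebra

/-! ### Brackets on `𝔤 = 𝔨 ⊕ 𝔭` -/

section Brackets

variable (𝔨 𝔭 : Type*) [AddCommGroup 𝔨] [Module ℝ 𝔨] [AddCommGroup 𝔭] [Module ℝ 𝔭]

/-- Bilinear maps `𝔤 × 𝔤 → 𝔤` on `𝔤 = 𝔨 × 𝔭`. -/
abbrev BilinearBracket : Type _ := (𝔨 × 𝔭) →ₗ[ℝ] (𝔨 × 𝔭) →ₗ[ℝ] (𝔨 × 𝔭)

variable {𝔨 𝔭}

/-- `μ` is a Lie bracket: alternating, and it satisfies the Jacobi identity. -/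
structure IsLieBracket (μ : BilinearBracket 𝔨 𝔭) : Prop where
  self : ∀ x, μ x x = 0
  jacobi : ∀ x y z, μ x (μ y z) + μ y (μ z x) + μ z (μ x y) = 0

/-- The action `h̄ · μ = h̄ μ(h̄⁻¹ ·, h̄⁻¹ ·)` of `GL(𝔤)` on brackets. -/
def bracketAct (h : (𝔨 × 𝔭) ≃ₗ[ℝ] (𝔨 × 𝔭)) (μ : BilinearBracket 𝔨 𝔭) : BilinearBracket 𝔨 𝔭 :=
  LinearMap.mk₂ ℝ (fun x y => h (μ (h.symm x) (h.symm y)))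
    (by simp) (by simp) (by simp) (by simp)

/-- The representation `θ(A)μ = A μ(·, ·) - μ(A ·, ·) - μ(·, A ·)` of `gl(𝔤)` on brackets. -/
def bracketθ (A : Module.End ℝ (𝔨 × 𝔭)) (μ : BilinearBracket 𝔨 𝔭) : BilinearBracket 𝔨 𝔭 :=
  LinearMap.mk₂ ℝ (fun x y => A (μ x y) - μ (A x) y - μ x (A y))
    (fun x x' y => by simp only [map_add, LinearMap.add_apply]; abel)
    (fun c x y => by simp only [map_smul, LinearMap.smul_apply, smul_sub])
    (fun x y y' => by simp only [map_add]; abel)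
    (fun c x y => by simp only [map_smul, smul_sub])

/-- The operator `(I, c⁻¹ I)` of `𝔤 = 𝔨 ⊕ 𝔭`. -/
def scaleEquiv (c : ℝˣ) : (𝔨 × 𝔭) ≃ₗ[ℝ] (𝔨 × 𝔭) :=
  (LinearEquiv.refl ℝ 𝔨).prodCongr (LinearEquiv.smulOfNeZero ℝ 𝔭 (c : ℝ)⁻¹ (inv_ne_zero c.ne_zero))

/-- The scaling `c · μ = (I, c⁻¹ I) · μ`. -/
def scale (c : ℝˣ) (μ : BilinearBracket 𝔨 𝔭) : BilinearBracket 𝔨 𝔭 := bracketAct (scaleEquiv c) μ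

theorem scale_apply (c : ℝˣ) (μ : BilinearBracket 𝔨 𝔭) (x y : 𝔨 × 𝔭) :
    scale c μ x y =
      ((μ (x.1, (c : ℝ) • x.2) (y.1, (c : ℝ) • y.2)).1,
        (c : ℝ)⁻¹ • (μ (x.1, (c : ℝ) • x.2) (y.1, (c : ℝ) • y.2)).2) := by
  have e0 : ∀ z : 𝔨 × 𝔭, scaleEquiv c z = (z.1, (c : ℝ)⁻¹ • z.2) := fun z => rfl
  have e : ∀ z : 𝔨 × 𝔭, (scaleEquiv c).symm z = (z.1, (c : ℝ) • z.2) := by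
    intro z
    rw [LinearEquiv.symm_apply_eq, e0]
    simp
  simp only [scale, bracketAct, LinearMap.mk₂_apply, e, e0]

/-- On `𝔭 × 𝔭`, `c · μ = c² μ_𝔨 + c μ_𝔭`. -/
theorem scale_apply_pp (c : ℝˣ) (μ : BilinearBracket 𝔨 𝔭) (X Y : 𝔭) :
    scale c μ (0, X) (0, Y) =
      ((c : ℝ) ^ 2 • (μ (0, X) (0, Y)).1, (c : ℝ) • (μ (0, X) (0, Y)).2) := by
  have e : ∀ Z : 𝔭, ((0 : 𝔨), (c : ℝ) • Z) = (c : ℝ) • ((0 : 𝔨), Z) := by simp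
  rw [scale_apply]
  simp only [e, map_smul, LinearMap.smul_apply, Prod.smul_fst, Prod.smul_snd, smul_smul]
  ext
  · simp [pow_two]
  · simp

/-- The block diagonal operator `[0 0; 0 A]` of `𝔤 = 𝔨 ⊕ 𝔭`. -/
def blockDiag (A : Module.End ℝ 𝔭) : Module.End ℝ (𝔨 × 𝔭) :=
  LinearMap.prodMap 0 A

/-- The `𝔭`-block `D_𝔭` of an operator `D` of `𝔤 = 𝔨 ⊕ 𝔭`. -/
def pBlock (D : Module.End ℝ (𝔨 × 𝔭)) : Module.End ℝ 𝔭 :=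
  LinearMap.snd ℝ 𝔨 𝔭 ∘ₗ D ∘ₗ LinearMap.inr ℝ 𝔨 𝔭

/-- `D ∈ Der(𝔤/𝔨)`: `D` is a derivation of `(𝔤, μ)` with `D(𝔨) ⊆ 𝔨`. -/
structure IsRelativeDerivation (μ : BilinearBracket 𝔨 𝔭) (D : Module.End ℝ (𝔨 × 𝔭)) : Prop where
  leibniz : ∀ x y, D (μ x y) = μ (D x) y + μ x (D y)
  preserves : ∀ Z : 𝔨, (D (Z, 0)).2 = 0

/-- The operator `ad_μ Z|_𝔭` of `𝔭` (followed by the projection on `𝔭`, which does nothing when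
`μ(𝔨, 𝔭) ⊆ 𝔭`). -/
def adP (μ : BilinearBracket 𝔨 𝔭) (Z : 𝔨) : Module.End ℝ 𝔭 := pBlock (μ (Z, 0))

end Brackets

/-! ### Tensor fields, preferred directions -/

section Geometry

variable (𝔨 𝔭 : Type*)
  [NormedAddCommGroup 𝔨] [NormedSpace ℝ 𝔨] [NormedAddCommGroup 𝔭] [NormedSpace ℝ 𝔭]

/-- `m`-tuples of tensor fields of type `(r, s)` on a manifold modelled on `𝔭`. -/
abbrev TensorField (m r s : ℕ) (M : Type) [TopologicalSpace M] [ChartedSpace 𝔭 M] : Type _ :=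
  ∀ x : M, Tensors m r s (TangentSpace 𝓘(ℝ, 𝔭) x)

variable {𝔨 𝔭} {m r s : ℕ}

/-- The tensor fields `τ` on `M` and `τ'` on `N` are related by `f : M → N`.  For a diffeomorphism
`f` this says `τ = f^* τ'`. -/
def FieldRelated {M N : Type} [TopologicalSpace M] [ChartedSpace 𝔭 M]
    [TopologicalSpace N] [ChartedSpace 𝔭 N] (f : M → N)
    (τ : TensorField 𝔭 m r s M) (τ' : TensorField 𝔭 m r s N) : Prop :=
  ∀ x : M, Related (mfderiv 𝓘(ℝ, 𝔭) 𝓘(ℝ, 𝔭) f x).toLinearMap (τ x) (τ' (f x))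

/-- A kind of geometric structure of the same type as the tensor `γ` on `𝔭`, together with a
diffeomorphism equivariant preferred direction `q` with scaling exponent `α`: on every smooth
manifold `M` of the dimension of `𝔭` a set `Γ` of tensor fields that are pointwise equivalent to
`γ`, and for every `τ ∈ Γ` a tensor field `q(τ)`, tangent to the orbit of `γ` (so pointwise in `T`).
-/
structure PreferredDirection (γ : Tensors m r s 𝔭) (T : Submodule ℝ (Tensors m r s 𝔭))
    (α : ℝ) where
  /-- The space of geometric structures on `M`. -/
  Γ : ∀ (M : Type) [TopologicalSpace M] [ChartedSpace 𝔭 M] [IsManifold 𝓘(ℝ, 𝔭) ∞ M],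
    Set (TensorField 𝔭 m r s M)
  /-- The preferred direction; only its values on `Γ` matter. -/
  q : ∀ (M : Type) [TopologicalSpace M] [ChartedSpace 𝔭 M] [IsManifold 𝓘(ℝ, 𝔭) ∞ M],
    TensorField 𝔭 m r s M → TensorField 𝔭 m r s M
  type_eq : ∀ (M : Type) [TopologicalSpace M] [ChartedSpace 𝔭 M] [IsManifold 𝓘(ℝ, 𝔭) ∞ M],
    ∀ τ ∈ Γ M, ∀ x : M, ∃ u : 𝔭 ≃ₗ[ℝ] TangentSpace 𝓘(ℝ, 𝔭) x, act u γ = τ x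
  tangent : ∀ (M : Type) [TopologicalSpace M] [ChartedSpace 𝔭 M] [IsManifold 𝓘(ℝ, 𝔭) ∞ M],
    ∀ τ ∈ Γ M, ∀ (x : M) (u : 𝔭 ≃ₗ[ℝ] TangentSpace 𝓘(ℝ, 𝔭) x), act u γ = τ x →
      ∃ v ∈ T, act u v = q M τ x
  equivariant : ∀ (M N : Type)
    [TopologicalSpace M] [ChartedSpace 𝔭 M] [IsManifold 𝓘(ℝ, 𝔭) ∞ M]
    [TopologicalSpace N] [ChartedSpace 𝔭 N] [IsManifold 𝓘(ℝ, 𝔭) ∞ N]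
    (f : Diffeomorph 𝓘(ℝ, 𝔭) 𝓘(ℝ, 𝔭) M N ∞)
    (τ : TensorField 𝔭 m r s M) (τ' : TensorField 𝔭 m r s N),
    FieldRelated f τ τ' → τ' ∈ Γ N → τ ∈ Γ M ∧ FieldRelated f (q M τ) (q N τ')
  scaling : ∀ (M : Type) [TopologicalSpace M] [ChartedSpace 𝔭 M] [IsManifold 𝓘(ℝ, 𝔭) ∞ M],
    ∀ τ ∈ Γ M, ∀ c : ℝ, 0 < c → c • τ ∈ Γ M ∧ q M (c • τ) = c ^ α • q M τ

/-! ### The homogeneous space `G_μ/K_μ` -/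

/-- A realization of the homogeneous space `G_μ/K_μ`: a simply connected Lie group `G` whose Lie
algebra is identified with `(𝔨 × 𝔭, μ)`, and a closed connected subgroup `K` with Lie algebra `𝔨`.
The smooth structure of `G ⧸ K` is the usual one (the unique one for which the projection is a
smooth submersion), and since the Lie algebra of `K` is the kernel of the differential at `1` of the
projection, the condition on `K` is stated as `ker_eq`. -/
structure HomogeneousSpace (μ : BilinearBracket 𝔨 𝔭) where
  G : Type
  [group : Group G]
  [topG : TopologicalSpace G]
  [chartedG : ChartedSpace (𝔨 × 𝔭) G]
  [lieG : LieGroup 𝓘(ℝ, 𝔨 × 𝔭) ∞ G]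
  [t2G : T2Space G]
  [simplyConnected : SimplyConnectedSpace G]
  lieIso : GroupLieAlgebra 𝓘(ℝ, 𝔨 × 𝔭) G ≃ₗ[ℝ] 𝔨 × 𝔭
  lieIso_bracket : ∀ X Y, lieIso ⁅X, Y⁆ = μ (lieIso X) (lieIso Y)
  K : Subgroup G
  isClosed_K : IsClosed (K : Set G)
  isConnected_K : IsConnected (K : Set G)
  [chartedM : ChartedSpace 𝔭 (G ⧸ K)]
  [manifoldM : IsManifold 𝓘(ℝ, 𝔭) ∞ (G ⧸ K)]
  proj_smooth : ContMDiff 𝓘(ℝ, 𝔨 × 𝔭) 𝓘(ℝ, 𝔭) ∞ (fun g : G => (g : G ⧸ K))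
  proj_submersion : ∀ g : G, Function.Surjective
    (mfderiv 𝓘(ℝ, 𝔨 × 𝔭) 𝓘(ℝ, 𝔭) (fun g : G => (g : G ⧸ K)) g)
  ker_eq : ∀ X : GroupLieAlgebra 𝓘(ℝ, 𝔨 × 𝔭) G,
    mfderiv 𝓘(ℝ, 𝔨 × 𝔭) 𝓘(ℝ, 𝔭) (fun g : G => (g : G ⧸ K)) 1 X = 0 ↔ (lieIso X).2 = 0

namespace HomogeneousSpace

attribute [instance] group topG chartedG lieG t2G simplyConnected chartedM manifoldM

variable {μ : BilinearBracket 𝔨 𝔭} (H : HomogeneousSpace μ)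

/-- The manifold `M = G_μ/K_μ`. -/
abbrev M : Type := H.G ⧸ H.K

/-- The origin of `G_μ/K_μ`. -/
def origin : H.M := ((1 : H.G) : H.G ⧸ H.K)

/-- The identification `𝔭 → T_o M`, `X ↦ dπ|_e X`. -/
def ident : 𝔭 →ₗ[ℝ] TangentSpace 𝓘(ℝ, 𝔭) H.origin :=
  (mfderiv 𝓘(ℝ, 𝔨 × 𝔭) 𝓘(ℝ, 𝔭) (fun g : H.G => (g : H.G ⧸ H.K)) 1).toLinearMap ∘ₗ
    H.lieIso.symm.toLinearMap ∘ₗ LinearMap.inr ℝ 𝔨 𝔭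

/-- `τ` is the `G_μ`-invariant tensor field on `G_μ/K_μ` with value `γ` at the origin, under the
identification of `T_o M` with `𝔭`. -/
structure IsInvariantExtension (γ : Tensors m r s 𝔭) (τ : TensorField 𝔭 m r s H.M) : Prop where
  invariant : ∀ a : H.G, FieldRelated (fun x : H.M => a • x) τ τ
  origin_eq : Related H.ident γ (τ H.origin)

end HomogeneousSpace

/-- The set `𝓗^γ` of the Lie brackets `μ` on `𝔤 = 𝔨 ⊕ 𝔭` that determine a simply connected almost
effective homogeneous space `G_μ/K_μ` with reductive decomposition `𝔤 = 𝔨 ⊕ 𝔭`, on which `γ` defines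
an invariant geometric structure.  The condition `realizable` says that the connected subgroup with
Lie algebra `𝔨` of the simply connected Lie group with Lie algebra `(𝔤, μ)` is closed. -/
structure MemH (γ : Tensors m r s 𝔭) (μ : BilinearBracket 𝔨 𝔭) : Prop where
  isLie : IsLieBracket μ
  kk : ∀ Z Z' : 𝔨, (μ (Z, 0) (Z', 0)).2 = 0
  kp : ∀ (Z : 𝔨) (X : 𝔭), (μ (Z, 0) (0, X)).1 = 0
  realizable : Nonempty (HomogeneousSpace μ)
  effective : ∀ Z : 𝔨, (∀ X : 𝔭, μ (Z, 0) (0, X) = 0) → Z = 0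
  invariant : ∀ Z : 𝔨, θ (adP μ Z) γ = 0

variable {γ : Tensors m r s 𝔭} {T : Submodule ℝ (Tensors m r s 𝔭)} {α : ℝ}

/-- `v = q(G_μ/K_μ, γ)`, a tensor on `𝔭`: the invariant tensor field on `G_μ/K_μ` determined by `γ`
belongs to `Γ`, and `v` is the value at the origin of its preferred direction. -/
def HasDirection (P : PreferredDirection γ T α) (μ : BilinearBracket 𝔨 𝔭)
    (v : Tensors m r s 𝔭) : Prop :=
  ∃ (H : HomogeneousSpace μ) (τ : TensorField 𝔭 m r s H.M),
    H.IsInvariantExtension γ τ ∧ τ ∈ P.Γ H.M ∧ Related H.ident v (P.q H.M τ H.origin)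

/-- `Q = Q_μ`: the operator `Q ∈ 𝔮` with `θ(Q)γ = q(G_μ/K_μ, γ)`. -/
def IsDirectionOperator (P : PreferredDirection γ T α) (𝔮 : Submodule ℝ (Module.End ℝ 𝔭))
    (μ : BilinearBracket 𝔨 𝔭) (Q : Module.End ℝ 𝔭) : Prop :=
  Q ∈ 𝔮 ∧ HasDirection P μ (θ Q γ)

/-! ### Algebraic solitons and the bracket flow -/

/-- `(G_μ/K_μ, γ)` is an algebraic soliton with constant `c` and derivation `D ∈ Der(𝔤/𝔨)`:
`Q_μ = c/(s-r) I + proj(D_𝔭)` and `proj(D_𝔭) = D_𝔭`, where `proj` is the projection of `gl(𝔭)` onto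
`𝔮` along `gl(𝔭)_γ`. -/
structure IsAlgebraicSoliton (P : PreferredDirection γ T α)
    {𝔮 : Submodule ℝ (Module.End ℝ 𝔭)} (h𝔮 : IsComplement γ 𝔮) (μ : BilinearBracket 𝔨 𝔭)
    (c : ℝ) (D : Module.End ℝ (𝔨 × 𝔭)) : Prop where
  derivation : IsRelativeDerivation μ D
  operator : IsDirectionOperator P 𝔮 μ
    ((c / ((s : ℝ) - (r : ℝ))) • (1 : Module.End ℝ 𝔭) +
      𝔮.projection (stab γ) h𝔮.isCompl (pBlock D))
  proj_eq : 𝔮.projection (stab γ) h𝔮.isCompl (pBlock D) = pBlock D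

/-- The curve `ν` of brackets in `𝓗^γ` is on the open interval `(a, b)` a solution of
`dν/dt = σ θ([0 0; 0 Q_ν]) ν`, where `σ = ±1` is a choice of sign. -/
def IsBracketFlowSolution (σ : ℤˣ) (P : PreferredDirection γ T α)
    (𝔮 : Submodule ℝ (Module.End ℝ 𝔭)) (ν : ℝ → BilinearBracket 𝔨 𝔭) (a b : ℝ) : Prop :=
  ∀ t ∈ Set.Ioo a b, MemH γ (ν t) ∧ ∃ Q : Module.End ℝ 𝔭, IsDirectionOperator P 𝔮 (ν t) Q ∧
    ∀ x y : 𝔨 × 𝔭, HasDerivAt (fun u => ν u x y)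
      (((σ : ℤ) : ℝ) • bracketθ (blockDiag Q) (ν t) x y) t

/-- `μ` is a fixed point up to scaling of the bracket flow: the solution `ν` starting at `μ` is
`ν(t) = c(t) · μ`, `c(t) ≠ 0`, on an open interval around `0`. -/
def IsFixedPointUpToScaling (σ : ℤˣ) (P : PreferredDirection γ T α)
    (𝔮 : Submodule ℝ (Module.End ℝ 𝔭)) (μ : BilinearBracket 𝔨 𝔭) : Prop :=
  ∃ (a b : ℝ) (ν : ℝ → BilinearBracket 𝔨 𝔭) (c : ℝ → ℝˣ), a < 0 ∧ 0 < b ∧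
    IsBracketFlowSolution σ P 𝔮 ν a b ∧ ν 0 = μ ∧ ∀ t ∈ Set.Ioo a b, ν t = scale (c t) μ

end Geometry

end HomSoliton

end

open HomSoliton

/-! The scalings `c · μ` form a ray through `μ`. Only the `𝔭 × 𝔭` block moves along it, and its
tangent at `c = 1` is `-θ([0 0; 0 I]) μ` (`bracketθ_blockDiag_one`, `hasDerivAt_scale`). Passing
from `μ` to `c · μ` keeps the homogeneous space and multiplies `𝔭 → T_o M` by `c`, so `γ` now
represents `c^(s-r) τ` instead of `τ`. Homogeneity of `q` then gives `Q_{c·μ} = c^k Q_μ` with `k =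
(s-r)(α-1)`, for `c > 0` (`HasDirection.scale`).

Soliton to fixed point: if `Q_μ = λ I + D_𝔭` with `[0 0; 0 D_𝔭]` a derivation, that part does not
contribute to `θ(Q)μ`. The flow stays on the ray and reduces to the scalar equation `c' = -σ λ
c^(k+1)`, solved near `0` by `exists_scaling_factor`.

Fixed point to soliton: the velocity at time `0` is tangent to the ray (`exists_velocity_eq_smul`),
so `θ([0 0; 0 Q]) μ = l' θ([0 0; 0 I]) μ` for some `l'`. Hence `[0 0; 0 Q - l' I]` is a derivation,
and its `𝔭`-block lies in `𝔮` because `Q` and `I` do. -/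

namespace HomSoliton

/-! ### Related tensors under rescaling -/

section Tensors

variable {m r s : ℕ} {V W : Type*} [AddCommGroup V] [Module ℝ V] [AddCommGroup W] [Module ℝ W]

theorem Related.smul {A : V →ₗ[ℝ] W} {γ : Tensors m r s V} {γ' : Tensors m r s W}
    (h : Related A γ γ') (d : ℝ) : Related A (d • γ) (d • γ') := by
  intro i v
  simp only [Pi.smul_apply, smul_apply, map_smul]
  rw [h i v]

theorem map_const_smul (c : ℝ) (A : V →ₗ[ℝ] W) :
    PiTensorProduct.map (fun _ : Fin s => c • A) =
      c ^ s • PiTensorProduct.map (fun _ : Fin s => A) := by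
  have h := (PiTensorProduct.mapMultilinear ℝ (fun _ : Fin s => V) (fun _ => W)).map_smul_univ
    (fun _ => c) (fun _ => A)
  simpa using h

/-- The `s` output slots contribute `c^s` on one side and the `r` input slots `c^r` on the other.
The powers are kept apart so that `c = 0` needs no exclusion. -/
theorem Related.smul_map {A : V →ₗ[ℝ] W} {γ : Tensors m r s V} {γ' : Tensors m r s W}
    (h : Related A γ γ') {c a b : ℝ} (e : c ^ s * a = c ^ r * b) :
    Related (c • A) (a • γ) (b • γ') := by
  intro i v
  have h1 : (γ' i) (fun j => c • A (v j)) = c ^ r • γ' i (fun j => A (v j)) := by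
    have := (γ' i).map_smul_univ (fun _ => c) (fun j => A (v j))
    simpa using this
  simp only [Pi.smul_apply, smul_apply, map_smul, LinearMap.smul_apply,
    map_const_smul, h1]
  rw [h i v, smul_smul, smul_smul, mul_comm a, e, mul_comm b]

end Tensors

/-! ### Brackets, scalings and `θ` in block form -/

section Brackets

variable {𝔨 𝔭 : Type*} [AddCommGroup 𝔨] [Module ℝ 𝔨] [AddCommGroup 𝔭] [Module ℝ 𝔭]

theorem scaleEquiv_apply (c : ℝˣ) (z : 𝔨 × 𝔭) :
    scaleEquiv c z = (z.1, (c : ℝ)⁻¹ • z.2) := rfl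

theorem scaleEquiv_symm_apply (c : ℝˣ) (z : 𝔨 × 𝔭) :
    (scaleEquiv c).symm z = (z.1, (c : ℝ) • z.2) := by
  rw [LinearEquiv.symm_apply_eq, scaleEquiv_apply]
  simp

theorem bracketθ_apply (A : Module.End ℝ (𝔨 × 𝔭)) (μ : BilinearBracket 𝔨 𝔭) (x y : 𝔨 × 𝔭) :
    bracketθ A μ x y = A (μ x y) - μ (A x) y - μ x (A y) := rfl

theorem bracketAct_apply (h : (𝔨 × 𝔭) ≃ₗ[ℝ] (𝔨 × 𝔭)) (μ : BilinearBracket 𝔨 𝔭) (x y : 𝔨 × 𝔭) :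
    bracketAct h μ x y = h (μ (h.symm x) (h.symm y)) := rfl

theorem bracketθ_add (A B : Module.End ℝ (𝔨 × 𝔭)) (μ : BilinearBracket 𝔨 𝔭) :
    bracketθ (A + B) μ = bracketθ A μ + bracketθ B μ := by
  refine LinearMap.ext₂ fun x y => ?_
  simp only [bracketθ_apply, LinearMap.add_apply, map_add]
  abel

theorem bracketθ_smul (c : ℝ) (A : Module.End ℝ (𝔨 × 𝔭)) (μ : BilinearBracket 𝔨 𝔭) :
    bracketθ (c • A) μ = c • bracketθ A μ := by
  refine LinearMap.ext₂ fun x y => ?_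
  simp only [bracketθ_apply, LinearMap.smul_apply, map_smul, smul_sub]

theorem blockDiag_apply (A : Module.End ℝ 𝔭) (z : 𝔨 × 𝔭) : blockDiag A z = (0, A z.2) := rfl

theorem blockDiag_add (A B : Module.End ℝ 𝔭) :
    (blockDiag (A + B) : Module.End ℝ (𝔨 × 𝔭)) = blockDiag A + blockDiag B := by
  refine LinearMap.ext fun z => ?_
  simp [blockDiag_apply]

theorem blockDiag_smul (c : ℝ) (A : Module.End ℝ 𝔭) :
    (blockDiag (c • A) : Module.End ℝ (𝔨 × 𝔭)) = c • blockDiag A := by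
  refine LinearMap.ext fun z => ?_
  simp [blockDiag_apply]

theorem pBlock_blockDiag (A : Module.End ℝ 𝔭) :
    pBlock (blockDiag A : Module.End ℝ (𝔨 × 𝔭)) = A := rfl

/-- `blockDiag A` commutes with the scalings. -/
theorem bracketθ_blockDiag_scale (A : Module.End ℝ 𝔭) (c : ℝˣ) (μ : BilinearBracket 𝔨 𝔭) :
    bracketθ (blockDiag A) (scale c μ) = scale c (bracketθ (blockDiag A) μ) := by
  have e1 : ∀ z : 𝔨 × 𝔭, blockDiag A (scaleEquiv c z) = scaleEquiv c (blockDiag A z) := by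
    intro z
    simp [blockDiag_apply, scaleEquiv_apply]
  have e2 : ∀ z : 𝔨 × 𝔭,
      (scaleEquiv c).symm (blockDiag A z) = blockDiag A ((scaleEquiv c).symm z) := by
    intro z
    simp [blockDiag_apply, scaleEquiv_symm_apply]
  refine LinearMap.ext₂ fun x y => ?_
  simp only [scale, bracketθ_apply, bracketAct_apply, e1, e2, map_sub]

theorem bracketθ_eq_zero_iff (D : Module.End ℝ (𝔨 × 𝔭)) (μ : BilinearBracket 𝔨 𝔭) :
    bracketθ D μ = 0 ↔ ∀ x y, D (μ x y) = μ (D x) y + μ x (D y) := by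
  constructor
  · intro h x y
    have := congrArg (fun b : BilinearBracket 𝔨 𝔭 => b x y) h
    simp only [bracketθ_apply, LinearMap.zero_apply] at this
    rw [← sub_eq_zero, ← this]
    abel
  · intro h
    refine LinearMap.ext₂ fun x y => ?_
    rw [bracketθ_apply, h]
    simp

theorem scale_zero (c : ℝˣ) : scale c (0 : BilinearBracket 𝔨 𝔭) = 0 := by
  refine LinearMap.ext₂ fun x y => ?_
  simp [scale, bracketAct_apply]

theorem scale_one (μ : BilinearBracket 𝔨 𝔭) : scale 1 μ = μ := by
  refine LinearMap.ext₂ fun x y => ?_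
  simp [scale_apply]

theorem IsLieBracket.antisymm {μ : BilinearBracket 𝔨 𝔭} (h : IsLieBracket μ) (x y : 𝔨 × 𝔭) :
    μ x y = -μ y x := by
  have h1 := h.self (x + y)
  simp only [map_add, LinearMap.add_apply, h.self, zero_add, add_zero] at h1
  rw [add_comm] at h1
  exact eq_neg_of_add_eq_zero_left h1

theorem IsLieBracket.bracketAct {μ : BilinearBracket 𝔨 𝔭} (h : IsLieBracket μ)
    (e : (𝔨 × 𝔭) ≃ₗ[ℝ] (𝔨 × 𝔭)) : IsLieBracket (bracketAct e μ) where
  self x := by simp [bracketAct_apply, h.self]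
  jacobi x y z := by
    simp only [bracketAct_apply, LinearEquiv.symm_apply_apply, ← map_add, h.jacobi, map_zero]

/-- A bracket of a reductive decomposition, by blocks. -/
theorem apply_eq_blocks {μ : BilinearBracket 𝔨 𝔭} (hL : IsLieBracket μ)
    (kk : ∀ Z Z' : 𝔨, (μ (Z, 0) (Z', 0)).2 = 0)
    (kp : ∀ (Z : 𝔨) (X : 𝔭), (μ (Z, 0) (0, X)).1 = 0) (x y : 𝔨 × 𝔭) :
    μ x y = ((μ (x.1, 0) (y.1, 0)).1 + (μ (0, x.2) (0, y.2)).1,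
      (μ (x.1, 0) (0, y.2)).2 - (μ (y.1, 0) (0, x.2)).2 + (μ (0, x.2) (0, y.2)).2) := by
  have hx : ∀ z : 𝔨 × 𝔭, z = (z.1, 0) + (0, z.2) := fun z => by simp
  conv_lhs => rw [hx x, hx y]
  simp only [map_add, LinearMap.add_apply]
  rw [hL.antisymm (0, x.2) (y.1, 0)]
  ext
  · simp [kp]
  · simp [kk]
    abel

/-- `c · μ`, by blocks: only the component on `𝔭 × 𝔭` depends on `c`. -/
theorem scale_eq_blocks {μ : BilinearBracket 𝔨 𝔭} (hL : IsLieBracket μ)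
    (kk : ∀ Z Z' : 𝔨, (μ (Z, 0) (Z', 0)).2 = 0)
    (kp : ∀ (Z : 𝔨) (X : 𝔭), (μ (Z, 0) (0, X)).1 = 0) (c : ℝˣ) (x y : 𝔨 × 𝔭) :
    scale c μ x y =
      ((μ (x.1, 0) (y.1, 0)).1, (μ (x.1, 0) (0, y.2)).2 - (μ (y.1, 0) (0, x.2)).2) +
      ((c : ℝ) ^ 2 • (μ (0, x.2) (0, y.2)).1, (c : ℝ) • (μ (0, x.2) (0, y.2)).2) := by
  have e : ∀ Z : 𝔭, ((0 : 𝔨), (c : ℝ) • Z) = (c : ℝ) • ((0 : 𝔨), Z) := by simp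
  have hc : (c : ℝ) ≠ 0 := c.ne_zero
  rw [scale_apply, apply_eq_blocks hL kk kp]
  simp only [e, map_smul, LinearMap.smul_apply, Prod.smul_fst, Prod.smul_snd, smul_smul]
  -- On `𝔨 × 𝔭` the factor `c` of the input cancels the `c⁻¹` of the output; on `𝔭 × 𝔭` there are
  -- two input factors.
  ext
  · simp [pow_two]
  · simp [smul_add, smul_sub, smul_smul, hc]

/-- `-θ([0 0; 0 I])` is the infinitesimal generator of the scalings. -/
theorem bracketθ_blockDiag_one {μ : BilinearBracket 𝔨 𝔭} (hL : IsLieBracket μ)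
    (kk : ∀ Z Z' : 𝔨, (μ (Z, 0) (Z', 0)).2 = 0)
    (kp : ∀ (Z : 𝔨) (X : 𝔭), (μ (Z, 0) (0, X)).1 = 0) (x y : 𝔨 × 𝔭) :
    bracketθ (blockDiag 1) μ x y =
      -((2 : ℝ) • (μ (0, x.2) (0, y.2)).1, (μ (0, x.2) (0, y.2)).2) := by
  rw [bracketθ_apply]
  simp only [blockDiag_apply, Module.End.one_apply]
  rw [apply_eq_blocks hL kk kp x y, apply_eq_blocks hL kk kp (0, x.2) y,
    apply_eq_blocks hL kk kp x (0, y.2)]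
  -- `θ` counts `𝔭`-outputs minus `𝔭`-inputs: `0` on the blocks involving `𝔨`, `-2` on `𝔭 × 𝔭 → 𝔨`,
  -- `-1` on `𝔭 × 𝔭 → 𝔭`.
  ext
  · simp [show (((0 : 𝔨), (0 : 𝔭)) : 𝔨 × 𝔭) = 0 from rfl, two_smul]
    abel
  · simp [show (((0 : 𝔨), (0 : 𝔭)) : 𝔨 × 𝔭) = 0 from rfl]

end Brackets

/-! ### Scaling of `G_μ/K_μ` and of `Q_μ` -/

section Geometry

variable {𝔨 𝔭 : Type*}
  [NormedAddCommGroup 𝔨] [NormedSpace ℝ 𝔨] [NormedAddCommGroup 𝔭] [NormedSpace ℝ 𝔭]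
  {m r s : ℕ}

namespace HomogeneousSpace

/-- The same homogeneous space, with the identification of the Lie algebra scaled. -/
noncomputable def scale {μ : BilinearBracket 𝔨 𝔭} (H : HomogeneousSpace μ) (c : ℝˣ) :
    HomogeneousSpace (HomSoliton.scale c μ) where
  G := H.G
  lieIso := H.lieIso.trans (scaleEquiv c)
  lieIso_bracket X Y := by
    simp [HomSoliton.scale, bracketAct_apply, H.lieIso_bracket]
  K := H.K
  isClosed_K := H.isClosed_K
  isConnected_K := H.isConnected_K
  proj_smooth := H.proj_smooth
  proj_submersion := H.proj_submersion
  ker_eq X := by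
    rw [H.ker_eq]
    simp [scaleEquiv_apply]

theorem scale_ident {μ : BilinearBracket 𝔨 𝔭} (H : HomogeneousSpace μ) (c : ℝˣ) :
    (H.scale c).ident = (c : ℝ) • H.ident := by
  refine LinearMap.ext fun X => ?_
  have e : (scaleEquiv c).symm ((0 : 𝔨), X) = (c : ℝ) • ((0 : 𝔨), X) := by
    simp [scaleEquiv_symm_apply]
  change (mfderiv 𝓘(ℝ, 𝔨 × 𝔭) 𝓘(ℝ, 𝔭) (fun g : H.G => (g : H.G ⧸ H.K)) 1)
    (H.lieIso.symm ((scaleEquiv c).symm (0, X))) = (c : ℝ) •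
    (mfderiv 𝓘(ℝ, 𝔨 × 𝔭) 𝓘(ℝ, 𝔭) (fun g : H.G => (g : H.G ⧸ H.K)) 1) (H.lieIso.symm (0, X))
  rw [e, map_smul, map_smul]

end HomogeneousSpace

variable {γ : Tensors m r s 𝔭} {T : Submodule ℝ (Tensors m r s 𝔭)} {α : ℝ}

/-- Effectiveness and invariance only see the isotropy action of `𝔨` on `𝔭`, which scaling leaves
unchanged. -/
theorem MemH.scale {μ : BilinearBracket 𝔨 𝔭} (h : MemH γ μ) (c : ℝˣ) : MemH γ (scale c μ) where
  isLie := h.isLie.bracketAct _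
  kk Z Z' := by simp [scale_apply, h.kk]
  kp Z X := by
    rw [scale_eq_blocks h.isLie h.kk h.kp]
    simp [show (((0 : 𝔨), (0 : 𝔭)) : 𝔨 × 𝔭) = 0 from rfl]
  realizable := h.realizable.map fun H => H.scale c
  effective Z hZ := by
    refine h.effective Z fun X => Prod.ext (h.kp Z X) ?_
    have := congrArg Prod.snd (hZ X)
    rw [scale_eq_blocks h.isLie h.kk h.kp] at this
    simpa [show (((0 : 𝔨), (0 : 𝔭)) : 𝔨 × 𝔭) = 0 from rfl] using this
  invariant Z := by
    have : adP (HomSoliton.scale c μ) Z = adP μ Z := by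
      refine LinearMap.ext fun X => ?_
      change (HomSoliton.scale c μ (Z, 0) (0, X)).2 = (μ (Z, 0) (0, X)).2
      rw [scale_eq_blocks h.isLie h.kk h.kp]
      simp [show (((0 : 𝔨), (0 : 𝔭)) : 𝔨 × 𝔭) = 0 from rfl]
    rw [this]
    exact h.invariant Z

/-- `q(G_{cμ}/K_{cμ}, γ) = c^{(s-r)(α-1)} q(G_μ/K_μ, γ)` for `c > 0`. -/
theorem HasDirection.scale {P : PreferredDirection γ T α} {μ : BilinearBracket 𝔨 𝔭}
    {v : Tensors m r s 𝔭} (h : HasDirection P μ v) (c : ℝˣ) (hc : 0 < (c : ℝ)) :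
    HasDirection P (scale c μ) ((c : ℝ) ^ (((s : ℝ) - r) * (α - 1)) • v) := by
  obtain ⟨H, τ, hτ, hΓ, hv⟩ := h
  have hd : 0 < (c : ℝ) ^ ((s : ℝ) - r) := Real.rpow_pos_of_pos hc _
  obtain ⟨hΓ', hq⟩ := P.scaling H.M τ hΓ _ hd
  have hinv : ∀ a : H.G, FieldRelated (fun x : H.M => a • x)
      ((c : ℝ) ^ ((s : ℝ) - r) • τ) ((c : ℝ) ^ ((s : ℝ) - r) • τ) :=
    fun a x => (hτ.invariant a x).smul _
  -- The manifold is the same, so the new invariant field is a multiple of `τ`; the factor `d =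
  -- c^(s-r)` is forced by `c^s = c^r d`.
  refine ⟨H.scale c, (c : ℝ) ^ ((s : ℝ) - r) • τ, ⟨?_, ?_⟩, hΓ', ?_⟩
  · exact fun a x => hinv a x
  · rw [H.scale_ident]
    have := hτ.origin_eq.smul_map (c := c) (a := 1) (b := (c : ℝ) ^ ((s : ℝ) - r)) (by
      rw [← Real.rpow_natCast, ← Real.rpow_natCast, ← Real.rpow_add hc]; simp)
    rw [one_smul] at this
    exact this
  · rw [H.scale_ident]
    change Related _ _ (P.q H.M ((c : ℝ) ^ ((s : ℝ) - r) • τ) H.origin)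
    rw [hq]
    -- Exponents: `s + (s-r)(α-1) = r + (s-r)α`.
    refine hv.smul_map ?_
    rw [← Real.rpow_mul hc.le, ← Real.rpow_natCast, ← Real.rpow_natCast, ← Real.rpow_add hc,
      ← Real.rpow_add hc]
    congr 1
    ring

theorem IsDirectionOperator.scale {P : PreferredDirection γ T α}
    {𝔮 : Submodule ℝ (Module.End ℝ 𝔭)} {μ : BilinearBracket 𝔨 𝔭} {Q : Module.End ℝ 𝔭}
    (h : IsDirectionOperator P 𝔮 μ Q) (c : ℝˣ) (hc : 0 < (c : ℝ)) :
    IsDirectionOperator P 𝔮 (scale c μ) ((c : ℝ) ^ (((s : ℝ) - r) * (α - 1)) • Q) := by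
  refine ⟨𝔮.smul_mem _ h.1, ?_⟩
  rw [θ_smul]
  exact h.2.scale c hc

/-! ### Curves of scalings -/

/-- The velocity of a curve of scalings of a bracket. -/
theorem hasDerivAt_scale {μ : BilinearBracket 𝔨 𝔭} (h : MemH γ μ) {c : ℝ → ℝˣ} {c' t : ℝ}
    (hc : HasDerivAt (fun u => (c u : ℝ)) (c' * c t) t) (x y : 𝔨 × 𝔭) :
    HasDerivAt (fun u => scale (c u) μ x y)
      (-c' • bracketθ (blockDiag 1) (scale (c t) μ) x y) t := by
  have h' := h.scale (c t)
  rw [bracketθ_blockDiag_one h'.isLie h'.kk h'.kp, scale_apply_pp]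
  simp only [scale_eq_blocks h.isLie h.kk h.kp]
  -- The blocks involving `𝔨` are constant in `c`. Here `c'` is the logarithmic derivative of the
  -- factor, so the velocity is expressed through `scale (c t) μ` itself.
  refine HasDerivAt.const_add _ ?_
  refine (((hc.pow 2).smul_const (μ (0, x.2) (0, y.2)).1).prodMk
    (hc.smul_const (μ (0, x.2) (0, y.2)).2)).congr_deriv ?_
  ext
  · simp only [Prod.neg_mk, Prod.smul_mk, smul_neg, neg_smul, neg_neg, smul_smul]
    congr 1
    push_cast
    ring
  · simp only [Prod.neg_mk, Prod.smul_mk, smul_neg, neg_smul, neg_neg, smul_smul]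

/-- Apply a continuous functional equal to `1` at `w`. -/
theorem exists_hasDerivAt_of_smul_const {E : Type*} [NormedAddCommGroup E] [NormedSpace ℝ E]
    {f : ℝ → ℝ} {w w' : E} {t : ℝ} (hw : w ≠ 0) (h : HasDerivAt (fun u => f u • w) w' t) :
    ∃ f', HasDerivAt f f' t := by
  obtain ⟨g, hg⟩ := SeparatingDual.exists_eq_one (R := ℝ) hw
  refine ⟨g w', ?_⟩
  simpa [Function.comp_def, hg] using g.hasFDerivAt.comp_hasDerivAt t h

/-- If a curve of scalings of `μ` passes through `μ` and is differentiable there, then its velocity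
is tangent to the ray of scalings of `μ`; the scaling factor itself need not be differentiable. -/
theorem exists_velocity_eq_smul {μ : BilinearBracket 𝔨 𝔭} (h : MemH γ μ) {c : ℝ → ℝˣ} {t : ℝ}
    {ν : BilinearBracket 𝔨 𝔭} (h0 : scale (c t) μ = μ)
    (hν : ∀ x y, HasDerivAt (fun u => scale (c u) μ x y) (ν x y) t) :
    ∃ a : ℝ, ν = a • bracketθ (blockDiag 1) μ := by
  have hfst : ∀ x y : 𝔨 × 𝔭, HasDerivAt (fun u => (c u : ℝ) ^ 2 • (μ (0, x.2) (0, y.2)).1)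
      (ν x y).1 t := by
    intro x y
    have := (ContinuousLinearMap.fst ℝ 𝔨 𝔭).hasFDerivAt.comp_hasDerivAt t (hν x y)
    simp only [scale_eq_blocks h.isLie h.kk h.kp] at this
    simpa [Function.comp_def] using this.add_const (-(μ (x.1, 0) (y.1, 0)).1)
  have hsnd : ∀ x y : 𝔨 × 𝔭, HasDerivAt (fun u => (c u : ℝ) • (μ (0, x.2) (0, y.2)).2)
      (ν x y).2 t := by
    intro x y
    have := (ContinuousLinearMap.snd ℝ 𝔨 𝔭).hasFDerivAt.comp_hasDerivAt t (hν x y)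
    simp only [scale_eq_blocks h.isLie h.kk h.kp] at this
    simpa [Function.comp_def] using
      this.add_const (-((μ (x.1, 0) (0, y.2)).2 - (μ (y.1, 0) (0, x.2)).2))
  -- A nonzero `μ_𝔭` on `𝔭 × 𝔭` detects `c` itself, which is then differentiable with `c t = 1`.
  -- Otherwise only `c²` is visible, and the sign of `c` may jump.
  by_cases hp : ∃ X Y : 𝔭, (μ (0, X) (0, Y)).2 ≠ 0
  · obtain ⟨X, Y, hXY⟩ := hp
    obtain ⟨c', hc'⟩ := exists_hasDerivAt_of_smul_const hXY (hsnd (0, X) (0, Y))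
    have hct : (c t : ℝ) = 1 := by
      have h1 := congrArg (fun b : BilinearBracket 𝔨 𝔭 => (b (0, X) (0, Y)).2) h0
      simp only [scale_apply_pp] at h1
      exact smul_left_injective ℝ hXY (h1.trans (one_smul ℝ _).symm)
    refine ⟨-c', LinearMap.ext₂ fun x y => (hν x y).unique ?_⟩
    have h2 := hasDerivAt_scale h (c := c) (c' := c') (t := t) (by rwa [hct, mul_one]) x y
    rwa [h0] at h2
  · push Not at hp
    obtain ⟨a, ha⟩ : ∃ a : ℝ, ∀ x y : 𝔨 × 𝔭, (ν x y).1 = a • (μ (0, x.2) (0, y.2)).1 := by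
      by_cases hk : ∃ X Y : 𝔭, (μ (0, X) (0, Y)).1 ≠ 0
      · obtain ⟨X, Y, hXY⟩ := hk
        obtain ⟨a, ha⟩ := exists_hasDerivAt_of_smul_const hXY (hfst (0, X) (0, Y))
        exact ⟨a, fun x y => (hfst x y).unique (ha.smul_const _)⟩
      · push Not at hk
        refine ⟨0, fun x y => (hfst x y).unique ?_⟩
        simpa [hk] using hasDerivAt_const t (0 : 𝔨)
    -- `a` is the derivative of `c²` (or `0` if `μ_𝔨` vanishes as well), while the generator is `-2
    -- μ_𝔨`.
    refine ⟨-(a / 2), LinearMap.ext₂ fun x y => ?_⟩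
    rw [LinearMap.smul_apply, LinearMap.smul_apply, bracketθ_blockDiag_one h.isLie h.kk h.kp]
    ext
    · rw [ha]
      simp [smul_smul]
    · refine (hsnd x y).unique ?_
      simpa [hp] using hasDerivAt_const t (0 : 𝔭)

/-- The solution of `dc/dt = κ c^{k + 1}` with `c(0) = 1`, extended by a nonzero function. -/
theorem exists_scaling_factor {k : ℝ} (hk : k ≠ 0) (κ : ℝ) :
    ∃ (c : ℝ → ℝˣ) (ε : ℝ), 0 < ε ∧ c 0 = 1 ∧ (∀ t, 0 < (c t : ℝ)) ∧
      ∀ t ∈ Set.Ioo (-ε) ε,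
        HasDerivAt (fun u => (c u : ℝ)) (κ * (c t : ℝ) ^ k * c t) t := by
  -- The equation makes `c^(-k)` affine: `c^(-k) = b`. The form `exp(-(1/k) log b)` keeps `c`
  -- positive even where `b ≤ 0`, and the `+ 1` in `ε` covers `κ = 0`.
  let b : ℝ → ℝ := fun t => 1 - k * κ * t
  refine ⟨fun t => Units.mk0 (Real.exp (-(1 / k) * Real.log (b t))) (Real.exp_ne_zero _),
    1 / (|k * κ| + 1), by positivity, ?_, fun t => Real.exp_pos _, fun t ht => ?_⟩
  · ext
    simp [b]
  have hb : 0 < b t := by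
    have h1 : |t| < 1 / (|k * κ| + 1) := abs_lt.2 ht
    rw [lt_div_iff₀ (by positivity)] at h1
    have h2 : k * κ * t ≤ |k * κ| * |t| := (le_abs_self _).trans (abs_mul _ _).le
    have h3 := abs_nonneg t
    simp only [b]
    linarith
  have hd : HasDerivAt b (-(k * κ)) t := by
    simpa using ((hasDerivAt_id t).const_mul (k * κ)).const_sub 1
  refine ((hd.log hb.ne').const_mul (-(1 / k))).exp.congr_deriv ?_
  have hpow : Real.exp (-(1 / k) * Real.log (b t)) ^ k = (b t)⁻¹ := by
    rw [← Real.exp_mul, show -(1 / k) * Real.log (b t) * k = -Real.log (b t) by field_simp,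
      Real.exp_neg, Real.exp_log hb]
  rw [Units.val_mk0, hpow]
  field_simp

end Geometry

end HomSoliton

/-! ### The equivalence -/

open HomSoliton
theorem corollary6p3 {𝔨 𝔭 : Type*}
    [NormedAddCommGroup 𝔨] [NormedSpace ℝ 𝔨] [FiniteDimensional ℝ 𝔨]
    [NormedAddCommGroup 𝔭] [NormedSpace ℝ 𝔭] [FiniteDimensional ℝ 𝔭]
    {m r s : ℕ} (hrs : r ≠ s) {α : ℝ} (hα : α < 1)
    (γ : Tensors m r s 𝔭) (T : Submodule ℝ (Tensors m r s 𝔭)) (hT : OrbitIsOpenIn γ T)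
    (𝔮 : Submodule ℝ (Module.End ℝ 𝔭)) (h𝔮 : IsComplement γ 𝔮)
    (P : PreferredDirection γ T α)
    (σ : ℤˣ) (μ : BilinearBracket 𝔨 𝔭) (hμ : MemH γ μ) :
    (∃ (c : ℝ) (D : Module.End ℝ (𝔨 × 𝔭)),
        IsAlgebraicSoliton P h𝔮 μ c D ∧ D = blockDiag (pBlock D)) ↔
      IsFixedPointUpToScaling σ P 𝔮 μ := by
  have hsr : (s : ℝ) - r ≠ 0 := sub_ne_zero.2 (by exact_mod_cast hrs.symm)
  constructor
  · rintro ⟨c₀, D, hD, hDp⟩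
    have hop := hD.operator
    rw [hD.proj_eq] at hop
    have hder : bracketθ (blockDiag (pBlock D)) μ = 0 := by
      rw [← hDp, bracketθ_eq_zero_iff]
      exact hD.derivation.leibniz
    -- The constant comes from matching `-κ c^k θ(I)(c · μ)` with `σ c^k (c₀/(s-r)) θ(I)(c · μ)`.
    obtain ⟨c, ε, hε, hc0, hcpos, hc⟩ := exists_scaling_factor
      (k := ((s : ℝ) - r) * (α - 1)) (mul_ne_zero hsr (by linarith))
      (-(((σ : ℤ) : ℝ) * (c₀ / ((s : ℝ) - r))))
    refine ⟨-ε, ε, fun t => scale (c t) μ, c, by linarith, hε, fun t ht => ?_, ?_, fun t _ => rfl⟩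
    · refine ⟨hμ.scale (c t), _, hop.scale (c t) (hcpos t), fun x y => ?_⟩
      convert hasDerivAt_scale hμ (hc t ht) x y using 1
      rw [blockDiag_smul, blockDiag_add, blockDiag_smul, bracketθ_smul, bracketθ_add,
        bracketθ_blockDiag_scale (pBlock D), hder, scale_zero, add_zero, bracketθ_smul]
      simp only [LinearMap.smul_apply, smul_smul]
      congr 1
      ring
    · simp only [hc0]
      exact scale_one μ
  · rintro ⟨a, b, ν, c, ha, hb, hν, hν0, hνc⟩
    -- Only the flow equation at time `0` matters.
    obtain ⟨-, Q, hQ, hd⟩ := hν 0 ⟨ha, hb⟩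
    rw [hν0] at hQ hd
    obtain ⟨l, hl⟩ := exists_velocity_eq_smul hμ (c := c) (t := 0)
      (ν := ((σ : ℤ) : ℝ) • bracketθ (blockDiag Q) μ)
      (by rw [← hνc 0 ⟨ha, hb⟩, hν0]) (fun x y => by
        refine (hd x y).congr_of_eventuallyEq ?_
        filter_upwards [Ioo_mem_nhds ha hb] with u hu
        rw [hνc u hu])
    have hσ : ((σ : ℤ) : ℝ) * ((σ : ℤ) : ℝ) = 1 := by
      rw [← Int.cast_mul, ← Units.val_mul, Int.units_mul_self, Units.val_one, Int.cast_one]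
    set l' : ℝ := ((σ : ℤ) : ℝ) * l
    have hl' : bracketθ (blockDiag Q) μ = l' • bracketθ (blockDiag 1) μ := by
      have := congrArg (((σ : ℤ) : ℝ) • ·) hl
      simpa only [smul_smul, hσ, one_smul] using this
    have hA : Q - l' • (1 : Module.End ℝ 𝔭) ∈ 𝔮 := 𝔮.sub_mem hQ.1 (𝔮.smul_mem _ h𝔮.one_mem)
    have hproj : 𝔮.projection (stab γ) h𝔮.isCompl (Q - l' • 1) = Q - l' • 1 :=
      Submodule.projection_apply_of_mem_left h𝔮.isCompl hA
    -- The soliton constant is chosen so that `c/(s-r) = l'`.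
    refine ⟨l' * ((s : ℝ) - r), blockDiag (Q - l' • 1), ⟨⟨?_, fun Z => ?_⟩, ?_, ?_⟩, rfl⟩
    · rw [← bracketθ_eq_zero_iff, sub_eq_add_neg, ← neg_smul, blockDiag_add, blockDiag_smul,
        bracketθ_add, bracketθ_smul, hl', ← add_smul, add_neg_cancel, zero_smul]
    · simp [blockDiag_apply]
    · rw [pBlock_blockDiag, hproj, mul_div_cancel_right₀ _ hsr]
      simpa using hQ
    · rw [pBlock_blockDiag, hproj]
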